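/- Let $N\ge 0$ and $K\ge 1$ be integers. Let $C(S^{N-1}_{\mathbb C,K})$ (the algebra of the $K$-half-liberated complex sphere) be the universal unital $C^*$-algebra generated by $z_1,\dots,z_N$ subject to the relations $$\sum_i z_iz_i^*=1=\sum_i z_i^*z_i,\qquad [z_{i_1}\cdots z_{i_K},\,z_{j_1}\cdots z_{j_K}]=0=[z_{i_1}\cdots z_{i_K},\,z_{j_1}^*\cdots z_{j_K}^*]$$ for all indices $i_1,\dots,i_K,j_1,\dots,j_K\in\{1,\dots,N\}$. Let $S^{N-1}_{\mathbb C}=\{z\in\mathbb C^N:\sum_i|z_i|^2=1\}$, let $a_{i,c}\in C((S^{N-1}_{\mathbb C})^K)$ be the coordinate functions $a_{i,c}(x_0,\dots,x_{K-1})=(x_c)_i$, with $c$ taken modulo $K$, and let $\mathbb Z_K=\langle\tau\rangle$ act on $C((S^{N-1}_{\mathbb C})^K)$ by cyclic permutation of the factors, so that $\tau(a_{i,c})=a_{i,c+1}$. Let $C((S^{N-1}_{\mathbb C})^K)\rtimes\mathbb Z_K$ be the corresponding crossed product $C^*$-algebra, with its standard embedding $$\iota: C((S^{N-1}_{\mathbb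 C})^K)\rtimes\mathbb Z_K\hookrightarrow M_K\big(C((S^{N-1}_{\mathbb C})^K)\big),\qquad a\otimes\tau^j\mapsto\sum_{c\in\mathbb Z_K}\tau^c(a)\,E_{c,c+j}.$$ Then there is a unital $*$-homomorphism $\pi:C(S^{N-1}_{\mathbb C,K})\to C((S^{N-1}_{\mathbb C})^K)\rtimes\mathbb Z_K$ with $\pi(z_i)=a_{i,0}\otimes\tau$ for all $i$, and $\pi$ is injective. Consequently $$\iota\circ\pi:\;C(S^{N-1}_{\mathbb C,K})\to M_K\big(C((S^{N-1}_{\mathbb C})^K)\big)$$ is injective, i.e. it is a faithful matrix model for the $K$-half-liberated complex sphere. -/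

import Mathlib

open scoped ComplexConjugate

noncomputable section

/-! ## The free `*`-algebra on `N` generators -/

/-- The algebra `ℂ⟨z₁, …, z_N, z₁*, …, z_N*⟩` of noncommutative `*`-polynomials: the letter
`Sum.inl i` stands for `zᵢ` and `Sum.inr i` for `zᵢ*`. -/
def FreeStarAlg (N : ℕ) : Type := FreeAlgebra ℂ (Fin N ⊕ Fin N)

namespace FreeStarAlg

variable {N : ℕ}

instance : Ring (FreeStarAlg N) := inferInstanceAs (Ring (FreeAlgebra ℂ (Fin N ⊕ Fin N)))

instance : Algebra ℂ (FreeStarAlg N) :=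
  inferInstanceAs (Algebra ℂ (FreeAlgebra ℂ (Fin N ⊕ Fin N)))

/-- The letters. -/
def letter (x : Fin N ⊕ Fin N) : FreeStarAlg N := FreeAlgebra.ι ℂ x

/-- The algebra map determined by the images of the letters. -/
def liftLetters {B : Type*} [Semiring B] [Algebra ℂ B] (f : Fin N ⊕ Fin N → B) :
    FreeStarAlg N →ₐ[ℂ] B :=
  FreeAlgebra.lift ℂ f

theorem liftLetters_letter {B : Type*} [Semiring B] [Algebra ℂ B] (f : Fin N ⊕ Fin N → B)
    (x : Fin N ⊕ Fin N) : liftLetters f (letter x) = f x :=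
  FreeAlgebra.lift_ι_apply f x

theorem induction {C : FreeStarAlg N → Prop}
    (hs : ∀ c : ℂ, C (algebraMap ℂ (FreeStarAlg N) c)) (hl : ∀ x, C (letter x))
    (hm : ∀ a b, C a → C b → C (a * b)) (ha : ∀ a b, C a → C b → C (a + b))
    (p : FreeStarAlg N) : C p :=
  FreeAlgebra.induction ℂ (Fin N ⊕ Fin N) (motive := C) hs hl hm ha p

/-- The opposite of the free `*`-algebra with scalars acting through complex conjugation (an
auxiliary algebra, used only to build the involution). -/
def ConjOp (N : ℕ) : Type := (FreeStarAlg N)ᵐᵒᵖ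

instance : Ring (ConjOp N) := inferInstanceAs (Ring (FreeStarAlg N)ᵐᵒᵖ)

instance : Algebra ℂ (ConjOp N) :=
  RingHom.toAlgebra' ((algebraMap ℂ (FreeStarAlg N)ᵐᵒᵖ).comp (starRingEnd ℂ))
    (fun c x => Algebra.commutes (A := (FreeStarAlg N)ᵐᵒᵖ) (conj c) x)

/-- The involution as a ring map into the opposite ring: it is conjugate-linear, reverses products
and exchanges `zᵢ` and `zᵢ*`. -/
def starHom (N : ℕ) : FreeStarAlg N →+* (FreeStarAlg N)ᵐᵒᵖ :=
  (liftLetters (B := ConjOp N) (fun x => MulOpposite.op (letter x.swap))).toRingHom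

theorem starHom_letter (x : Fin N ⊕ Fin N) :
    starHom N (letter x) = MulOpposite.op (letter x.swap) :=
  liftLetters_letter (B := ConjOp N) _ x

theorem starHom_algebraMap (c : ℂ) :
    starHom N (algebraMap ℂ _ c) = MulOpposite.op (algebraMap ℂ _ (conj c)) :=
  (liftLetters (B := ConjOp N) (fun x => MulOpposite.op (letter x.swap))).commutes c

instance : StarRing (FreeStarAlg N) where
  star p := (starHom N p).unop
  star_involutive p := by
    induction p using FreeStarAlg.induction with
    | hs c => simp [starHom_algebraMap]
    | hl x => simp [starHom_letter]
    | hm a b ha hb => simp [ha, hb]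
    | ha a b ha hb => simp [ha, hb]
  star_mul a b := by simp
  star_add a b := by simp

theorem star_def (p : FreeStarAlg N) : star p = (starHom N p).unop := rfl

theorem star_letter (x : Fin N ⊕ Fin N) : star (letter x) = letter x.swap := by
  simp [star_def, starHom_letter]

theorem star_algebraMap (c : ℂ) :
    star (algebraMap ℂ (FreeStarAlg N) c) = algebraMap ℂ _ (conj c) := by
  simp [star_def, starHom_algebraMap]

instance : StarModule ℂ (FreeStarAlg N) where
  star_smul c p := by
    rw [Algebra.smul_def, star_mul, star_algebraMap, Algebra.smul_def, Algebra.commutes]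
    rfl

/-- Evaluation of a `*`-polynomial at a tuple of elements of a `*`-algebra. -/
def eval {B : Type*} [Ring B] [StarRing B] [Algebra ℂ B] [StarModule ℂ B] (z : Fin N → B) :
    FreeStarAlg N →⋆ₐ[ℂ] B where
  __ := liftLetters (Sum.elim z (fun i => star (z i)))
  map_star' p := by
    change liftLetters _ _ = star (liftLetters _ _)
    induction p using FreeStarAlg.induction with
    | hs c => rw [star_algebraMap, AlgHom.commutes, AlgHom.commutes]; exact algebraMap_star_comm c
    | hl x => cases x <;> simp [star_letter, liftLetters_letter]
    | hm a b ha hb => simp [ha, hb]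
    | ha a b ha hb => simp [ha, hb]

theorem eval_letter {B : Type*} [Ring B] [StarRing B] [Algebra ℂ B] [StarModule ℂ B]
    (z : Fin N → B) (x : Fin N ⊕ Fin N) :
    eval z (letter x) = Sum.elim z (fun i => star (z i)) x :=
  liftLetters_letter _ x

end FreeStarAlg

/-! ## The `K`-half-liberated complex sphere -/

/-- The relations defining the `K`-half-liberated sphere: `∑ zᵢ zᵢ* = 1 = ∑ zᵢ* zᵢ` (the free
sphere) and `[z_{i₁} ⋯ z_{i_K}, z_{j₁} ⋯ z_{j_K}] = 0 = [z_{i₁} ⋯ z_{i_K}, z_{j₁}* ⋯ z_{j_K}*]`. -/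
structure IsHalfLiberated {N : ℕ} (K : ℕ) {B : Type*} [Ring B] [StarRing B] (z : Fin N → B) :
    Prop where
  sum_mul_star : ∑ i, z i * star (z i) = 1
  sum_star_mul : ∑ i, star (z i) * z i = 1
  commute : ∀ i j : Fin K → Fin N,
    Commute (List.ofFn fun k => z (i k)).prod (List.ofFn fun k => z (j k)).prod
  commute_star : ∀ i j : Fin K → Fin N,
    Commute (List.ofFn fun k => z (i k)).prod (List.ofFn fun k => star (z (j k))).prod

theorem IsHalfLiberated.norm_le_one {N K : ℕ} {B : Type*} [CStarAlgebra B] {z : Fin N → B}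
    (hz : IsHalfLiberated K z) (i : Fin N) : ‖z i‖ ≤ 1 := by
  let _ := CStarAlgebra.spectralOrder B
  have := CStarAlgebra.spectralOrderedRing B
  have h : star (z i) * z i ≤ 1 := by
    rw [← hz.sum_star_mul]
    exact Finset.single_le_sum (f := fun i => star (z i) * z i)
      (fun j _ => star_mul_self_nonneg (z j)) (Finset.mem_univ i)
  have h2 : ‖star (z i) * z i‖ ≤ 1 :=
    (CStarAlgebra.norm_le_one_iff_of_nonneg _ (star_mul_self_nonneg (z i))).2 h
  rw [CStarRing.norm_star_mul_self] at h2
  nlinarith [norm_nonneg (z i)]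

/-- The algebra of `*`-polynomials in `N` variables, to be normed by the largest `C*`-seminorm
compatible with the relations of the `K`-half-liberated sphere. -/
def HLPoly (N K : ℕ) : Type := FreeStarAlg N

namespace HLPoly

variable {N K : ℕ}

instance : Ring (HLPoly N K) := inferInstanceAs (Ring (FreeStarAlg N))
instance : Algebra ℂ (HLPoly N K) := inferInstanceAs (Algebra ℂ (FreeStarAlg N))
instance : StarRing (HLPoly N K) := inferInstanceAs (StarRing (FreeStarAlg N))
instance : StarModule ℂ (HLPoly N K) := inferInstanceAs (StarModule ℂ (FreeStarAlg N))

/-- Evaluation of a `*`-polynomial at a tuple. -/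
def eval {B : Type*} [Ring B] [StarRing B] [Algebra ℂ B] [StarModule ℂ B] (z : Fin N → B) :
    HLPoly N K →⋆ₐ[ℂ] B :=
  FreeStarAlg.eval z

/-- The values `‖p(z)‖`, for `z` an `N`-tuple in a `C*`-algebra satisfying the relations. (A
`C*`-algebra generated by `N` elements has at most the cardinality of the continuum, so algebras
in `Type` suffice.) -/
def normValues (p : HLPoly N K) : Set ℝ :=
  {r | ∃ (B : Type) (_ : CStarAlgebra B) (z : Fin N → B), IsHalfLiberated K z ∧ r = ‖eval z p‖}

/-- The universal `C*`-seminorm: the supremum of `‖p(z)‖` over all `z` as above. -/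
instance : Norm (HLPoly N K) where
  norm p := sSup (normValues p)

theorem norm_def (p : HLPoly N K) : ‖p‖ = sSup (normValues p) := rfl

theorem norm_one_le (B : Type*) [CStarAlgebra B] : ‖(1 : B)‖ ≤ 1 := by
  have h := CStarRing.norm_star_mul_self (x := (1 : B))
  rw [star_one, mul_one] at h
  nlinarith [norm_nonneg (1 : B), sq_nonneg (‖(1 : B)‖ - 1)]

/-- The supremum defining the universal seminorm is finite. -/
theorem bddAbove_normValues (p : HLPoly N K) : BddAbove (normValues p) := by
  suffices h : ∃ C : ℝ, 0 ≤ C ∧ ∀ (B : Type) (_ : CStarAlgebra B) (z : Fin N → B),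
      IsHalfLiberated K z → ‖eval z p‖ ≤ C by
    obtain ⟨C, -, hC⟩ := h
    refine ⟨C, ?_⟩
    rintro r ⟨B, _, z, hz, rfl⟩
    exact hC B _ z hz
  induction p using FreeStarAlg.induction with
  | hs c =>
    refine ⟨‖c‖, norm_nonneg c, fun B _ z _ => ?_⟩
    have h : eval z (algebraMap ℂ (HLPoly N K) c) = c • (1 : B) := by
      rw [AlgHomClass.commutes, Algebra.algebraMap_eq_smul_one]
    refine (congrArg norm h).trans_le ?_
    rw [norm_smul]
    exact mul_le_of_le_one_right (norm_nonneg c) (norm_one_le B)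
  | hl x =>
    refine ⟨1, zero_le_one, fun B _ z hz => ?_⟩
    refine (congrArg norm (FreeStarAlg.eval_letter z x)).trans_le ?_
    cases x with
    | inl i => exact hz.norm_le_one i
    | inr i => simpa using hz.norm_le_one i
  | hm a b ha hb =>
    obtain ⟨C, hC0, hC⟩ := ha
    obtain ⟨D, hD0, hD⟩ := hb
    refine ⟨C * D, mul_nonneg hC0 hD0, fun B _ z hz => ?_⟩
    refine (congrArg norm (map_mul (eval (K := K) z) a b)).trans_le ?_
    exact (norm_mul_le _ _).trans
      (mul_le_mul (hC B _ z hz) (hD B _ z hz) (norm_nonneg _) hC0)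
  | ha a b ha hb =>
    obtain ⟨C, hC0, hC⟩ := ha
    obtain ⟨D, hD0, hD⟩ := hb
    refine ⟨C + D, add_nonneg hC0 hD0, fun B _ z hz => ?_⟩
    refine (congrArg norm (map_add (eval (K := K) z) a b)).trans_le ?_
    exact (norm_add_le _ _).trans (add_le_add (hC B _ z hz) (hD B _ z hz))

theorem norm_eval_le (p : HLPoly N K) {B : Type} [CStarAlgebra B] {z : Fin N → B}
    (hz : IsHalfLiberated K z) : ‖eval z p‖ ≤ ‖p‖ :=
  le_csSup (bddAbove_normValues p) ⟨B, _, z, hz, rfl⟩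

theorem norm_le_of {p : HLPoly N K} {C : ℝ} (hC : 0 ≤ C)
    (h : ∀ (B : Type) [CStarAlgebra B] (z : Fin N → B), IsHalfLiberated K z → ‖eval z p‖ ≤ C) :
    ‖p‖ ≤ C := by
  refine Real.sSup_le ?_ hC
  rintro r ⟨B, _, z, hz, rfl⟩
  exact h B z hz

theorem norm_nonneg' (p : HLPoly N K) : 0 ≤ ‖p‖ := by
  refine Real.sSup_nonneg ?_
  rintro r ⟨B, _, z, hz, rfl⟩
  exact norm_nonneg _

/-- The universal seminorm as a ring seminorm. -/
def ringSeminorm (N K : ℕ) : RingSeminorm (HLPoly N K) where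
  toFun p := ‖p‖
  map_zero' := le_antisymm (norm_le_of le_rfl fun B _ z _ => by simp) (norm_nonneg' _)
  add_le' p q := norm_le_of (add_nonneg (norm_nonneg' p) (norm_nonneg' q)) fun B _ z hz => by
    rw [map_add]
    exact (norm_add_le _ _).trans (add_le_add (norm_eval_le p hz) (norm_eval_le q hz))
  neg' p := by
    simp only [norm_def, normValues, map_neg, norm_neg]
  mul_le' p q := norm_le_of (mul_nonneg (norm_nonneg' p) (norm_nonneg' q)) fun B _ z hz => by
    rw [map_mul]
    exact (norm_mul_le _ _).trans
      (mul_le_mul (norm_eval_le p hz) (norm_eval_le q hz) (norm_nonneg _) (norm_nonneg' p))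

instance : SeminormedRing (HLPoly N K) := (ringSeminorm N K).toSeminormedRing

instance : NormedAlgebra ℂ (HLPoly N K) where
  norm_smul_le c p := norm_le_of (mul_nonneg (norm_nonneg c) (norm_nonneg' p))
    fun B _ z hz => by
      rw [map_smul, norm_smul]
      exact mul_le_mul_of_nonneg_left (norm_eval_le p hz) (norm_nonneg c)

instance : NormedStarGroup (HLPoly N K) where
  norm_star_le p := norm_le_of (norm_nonneg' p) fun B _ z hz => by
    rw [map_star, norm_star]
    exact norm_eval_le p hz

theorem norm_mul_self_le (p : HLPoly N K) : ‖p‖ * ‖p‖ ≤ ‖star p * p‖ := by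
  have h : ‖p‖ ≤ √‖star p * p‖ := norm_le_of (Real.sqrt_nonneg _) fun B _ z hz => by
    refine Real.le_sqrt_of_sq_le ?_
    rw [sq, ← CStarRing.norm_star_mul_self, ← map_star, ← map_mul]
    exact norm_eval_le _ hz
  calc ‖p‖ * ‖p‖ ≤ √‖star p * p‖ * √‖star p * p‖ :=
        mul_le_mul h h (norm_nonneg _) (Real.sqrt_nonneg _)
    _ = _ := Real.mul_self_sqrt (norm_nonneg _)

end HLPoly

/-- `C(S^{N-1}_{ℂ,K})`, the algebra of the `K`-half-liberated complex sphere: the universal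
`C*`-algebra generated by `z₁, …, z_N` subject to `IsHalfLiberated`, constructed as the separated
completion of the `*`-polynomials for the universal `C*`-seminorm. -/
def HLSphere (N K : ℕ) : Type := UniformSpace.Completion (HLPoly N K)

namespace HLSphere

open UniformSpace

variable {N K : ℕ}

instance : NormedRing (HLSphere N K) :=
  inferInstanceAs (NormedRing (Completion (HLPoly N K)))

instance : CompleteSpace (HLSphere N K) :=
  inferInstanceAs (CompleteSpace (Completion (HLPoly N K)))

instance : Algebra ℂ (HLSphere N K) :=
  inferInstanceAs (Algebra ℂ (Completion (HLPoly N K)))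

/-- The class of a `*`-polynomial. -/
def ofPoly (p : HLPoly N K) : HLSphere N K := (p : Completion (HLPoly N K))

theorem denseRange_ofPoly : DenseRange (ofPoly : HLPoly N K → HLSphere N K) :=
  Completion.denseRange_coe

theorem norm_ofPoly (p : HLPoly N K) : ‖ofPoly p‖ = ‖p‖ := Completion.norm_coe p

theorem continuous_ofPoly : Continuous (ofPoly : HLPoly N K → HLSphere N K) :=
  Completion.continuous_coe _

theorem ofPoly_mul (p q : HLPoly N K) : ofPoly (p * q) = ofPoly p * ofPoly q :=
  Completion.coe_mul p q

theorem ofPoly_add (p q : HLPoly N K) : ofPoly (p + q) = ofPoly p + ofPoly q :=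
  Completion.coe_add p q

theorem ofPoly_smul (c : ℂ) (p : HLPoly N K) : ofPoly (c • p) = c • ofPoly p :=
  Completion.coe_smul c p

instance : NormedAlgebra ℂ (HLSphere N K) where
  norm_smul_le c x :=
    norm_smul_le (β := Completion (HLPoly N K)) c x

instance : Star (HLSphere N K) where
  star := Completion.map (star : HLPoly N K → HLPoly N K)

theorem continuous_star' : Continuous (star : HLSphere N K → HLSphere N K) :=
  Completion.continuous_map

theorem star_ofPoly (p : HLPoly N K) : star (ofPoly p) = ofPoly (star p) :=
  Completion.map_coe star_isometry.uniformContinuous p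

instance : StarRing (HLSphere N K) where
  star_involutive x := by
    refine denseRange_ofPoly.induction_on
      (p := fun x : HLSphere N K => star (star x) = x) x
      (isClosed_eq (continuous_star'.comp continuous_star') continuous_id) fun p => ?_
    rw [star_ofPoly, star_ofPoly, star_star]
  star_mul x y := by
    refine denseRange_ofPoly.induction_on₂
      (p := fun x y : HLSphere N K => star (x * y) = star y * star x) ?_ (fun p q => ?_) x y
    · exact isClosed_eq (continuous_star'.comp continuous_mul)
        ((continuous_star'.comp continuous_snd).mul (continuous_star'.comp continuous_fst))
    · rw [← ofPoly_mul, star_ofPoly, star_mul, ofPoly_mul, star_ofPoly, star_ofPoly]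
  star_add x y := by
    refine denseRange_ofPoly.induction_on₂
      (p := fun x y : HLSphere N K => star (x + y) = star x + star y) ?_ (fun p q => ?_) x y
    · exact isClosed_eq (continuous_star'.comp continuous_add)
        ((continuous_star'.comp continuous_fst).add (continuous_star'.comp continuous_snd))
    · rw [← ofPoly_add, star_ofPoly, star_add, ofPoly_add, star_ofPoly, star_ofPoly]

instance : StarModule ℂ (HLSphere N K) where
  star_smul c x := by
    refine denseRange_ofPoly.induction_on
      (p := fun x : HLSphere N K => star (c • x) = star c • star x) x
      (isClosed_eq (continuous_star'.comp (continuous_const_smul c))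
        ((continuous_const_smul (star c)).comp continuous_star')) fun p => ?_
    rw [← ofPoly_smul, star_ofPoly, star_smul, ofPoly_smul, star_ofPoly]

instance : CStarRing (HLSphere N K) where
  norm_mul_self_le x := by
    refine denseRange_ofPoly.induction_on
      (p := fun x : HLSphere N K => ‖x‖ * ‖x‖ ≤ ‖star x * x‖) x
      (isClosed_le (continuous_norm.mul continuous_norm)
        (continuous_norm.comp (continuous_star'.mul continuous_id))) fun p => ?_
    rw [star_ofPoly, ← ofPoly_mul, norm_ofPoly, norm_ofPoly]
    exact HLPoly.norm_mul_self_le p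

instance : CStarAlgebra (HLSphere N K) where

/-- The standard coordinates `zᵢ`. -/
def z (i : Fin N) : HLSphere N K := ofPoly (FreeStarAlg.letter (Sum.inl i) : FreeStarAlg N)

end HLSphere

/-! ## Crossed products by finite groups -/

/-- The crossed product `A ⋊ G` of a `C*`-algebra by an action `α` of a finite group (written
additively): elements are formal sums `∑ g, x g ⊗ g` with `x g ∈ A`, multiplied by
`(a ⊗ g) (b ⊗ h) = a α_g(b) ⊗ (g + h)`, with involution `(a ⊗ g)* = α_{-g}(a*) ⊗ (-g)`. As `G` is
finite no completion is needed. -/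
@[ext]
structure CrossedProduct {G A : Type*} [AddGroup G] [CStarAlgebra A]
    (α : Multiplicative G →* (A ≃⋆ₐ[ℂ] A)) where
  /-- The coefficient at a group element. -/
  coeff : G → A

namespace CrossedProduct

section Embedding

variable {G A : Type*} [AddGroup G] [CStarAlgebra A] {α : Multiplicative G →* (A ≃⋆ₐ[ℂ] A)}

/-- The automorphism by which `g : G` acts. -/
def act (α : Multiplicative G →* (A ≃⋆ₐ[ℂ] A)) (g : G) : A ≃⋆ₐ[ℂ] A :=
  α (Multiplicative.ofAdd g)

theorem act_zero (a : A) : act α 0 a = a := by simp [act]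

theorem act_act (g h : G) (a : A) : act α g (act α h a) = act α (g + h) a := by
  simp [act, ofAdd_add]

/-- The elementary element `a ⊗ g`. -/
def tmul [DecidableEq G] (a : A) (g : G) : CrossedProduct α := ⟨Pi.single g a⟩

instance : Zero (CrossedProduct α) := ⟨⟨0⟩⟩
instance [DecidableEq G] : One (CrossedProduct α) := ⟨tmul 1 0⟩
instance : Add (CrossedProduct α) := ⟨fun x y => ⟨x.coeff + y.coeff⟩⟩
instance : Neg (CrossedProduct α) := ⟨fun x => ⟨-x.coeff⟩⟩
instance : SMul ℂ (CrossedProduct α) := ⟨fun r x => ⟨r • x.coeff⟩⟩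
instance [Fintype G] : Mul (CrossedProduct α) :=
  ⟨fun x y => ⟨fun h => ∑ g, x.coeff g * act α g (y.coeff (-g + h))⟩⟩
instance : Star (CrossedProduct α) := ⟨fun x => ⟨fun g => act α g (star (x.coeff (-g)))⟩⟩

/-- The underlying map of the standard embedding `A ⋊ G ⊆ M_G(A)`, which sends `a ⊗ g` to
`∑ c, α_c(a) E_{c, c + g}`. -/
def toMatrixFun (x : CrossedProduct α) : CStarMatrix G G A :=
  CStarMatrix.ofMatrix fun c d => act α c (x.coeff (-c + d))

theorem toMatrixFun_apply (x : CrossedProduct α) (c d : G) :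
    toMatrixFun x c d = act α c (x.coeff (-c + d)) := rfl

theorem toMatrixFun_injective :
    Function.Injective (toMatrixFun : CrossedProduct α → CStarMatrix G G A) := by
  intro x y h
  ext g
  have h0 : toMatrixFun x 0 g = toMatrixFun y 0 g := by rw [h]
  simpa [toMatrixFun_apply, act_zero] using h0

theorem toMatrixFun_zero : toMatrixFun (0 : CrossedProduct α) = 0 := by
  ext c d
  exact map_zero (act α c)

theorem toMatrixFun_add (x y : CrossedProduct α) :
    toMatrixFun (x + y) = toMatrixFun x + toMatrixFun y := by
  ext c d
  exact map_add (act α c) _ _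

theorem toMatrixFun_neg (x : CrossedProduct α) : toMatrixFun (-x) = -toMatrixFun x := by
  ext c d
  exact map_neg (act α c) _

theorem toMatrixFun_smul (r : ℂ) (x : CrossedProduct α) :
    toMatrixFun (r • x) = r • toMatrixFun x := by
  ext c d
  exact map_smul (act α c) _ _

theorem toMatrixFun_star (x : CrossedProduct α) : toMatrixFun (star x) = star (toMatrixFun x) := by
  ext c d
  change act α c (act α (-c + d) (star (x.coeff (-(-c + d))))) = star (act α d (x.coeff (-d + c)))
  rw [act_act, ← map_star]
  simp

theorem toMatrixFun_one [DecidableEq G] : toMatrixFun (1 : CrossedProduct α) = 1 := by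
  ext c d
  change act α c (Pi.single (M := fun _ : G => A) 0 1 (-c + d)) = (1 : Matrix G G A) c d
  by_cases h : c = d
  · subst h
    simp
  · have h' : -c + d ≠ 0 := fun e => h (neg_add_eq_zero.1 e)
    simp [h, h']

theorem toMatrixFun_mul [Fintype G] (x y : CrossedProduct α) :
    toMatrixFun (x * y) = toMatrixFun x * toMatrixFun y := by
  ext c d
  change act α c (∑ g, x.coeff g * act α g (y.coeff (-g + (-c + d)))) =
    ∑ e, act α c (x.coeff (-c + e)) * act α e (y.coeff (-e + d))
  rw [map_sum]
  refine Fintype.sum_equiv (Equiv.addLeft c) _ _ fun g => ?_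
  rw [map_mul, act_act]
  simp [add_assoc]

end Embedding

section Algebra

variable {G A : Type*} [AddGroup G] [Fintype G] [DecidableEq G] [CStarAlgebra A]
  {α : Multiplicative G →* (A ≃⋆ₐ[ℂ] A)}

instance : Ring (CrossedProduct α) :=
  Ring.ofMinimalAxioms
    (fun x y z => toMatrixFun_injective <| by simp only [toMatrixFun_add, add_assoc])
    (fun x => toMatrixFun_injective <| by simp only [toMatrixFun_add, toMatrixFun_zero, zero_add])
    (fun x => toMatrixFun_injective <| by
      simp only [toMatrixFun_add, toMatrixFun_neg, toMatrixFun_zero, neg_add_cancel])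
    (fun x y z => toMatrixFun_injective <| by simp only [toMatrixFun_mul, mul_assoc])
    (fun x => toMatrixFun_injective <| by simp only [toMatrixFun_mul, toMatrixFun_one, one_mul])
    (fun x => toMatrixFun_injective <| by simp only [toMatrixFun_mul, toMatrixFun_one, mul_one])
    (fun x y z => toMatrixFun_injective <| by
      simp only [toMatrixFun_mul, toMatrixFun_add, mul_add])
    (fun x y z => toMatrixFun_injective <| by
      simp only [toMatrixFun_mul, toMatrixFun_add, add_mul])

/-- The embedding as an additive map. -/
def toMatrixAddHom : CrossedProduct α →+ CStarMatrix G G A where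
  toFun := toMatrixFun
  map_zero' := toMatrixFun_zero
  map_add' := toMatrixFun_add

instance : Module ℂ (CrossedProduct α) :=
  Function.Injective.module ℂ (toMatrixAddHom (α := α)) toMatrixFun_injective toMatrixFun_smul

instance : Algebra ℂ (CrossedProduct α) :=
  Algebra.ofModule
    (fun r x y => toMatrixFun_injective <| by
      simp only [toMatrixFun_mul, toMatrixFun_smul, smul_mul_assoc])
    (fun r x y => toMatrixFun_injective <| by
      simp only [toMatrixFun_mul, toMatrixFun_smul, mul_smul_comm])

instance : StarRing (CrossedProduct α) where
  star_involutive x := toMatrixFun_injective <| by simp only [toMatrixFun_star, star_star]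
  star_mul x y := toMatrixFun_injective <| by
    simp only [toMatrixFun_star, toMatrixFun_mul, star_mul]
  star_add x y := toMatrixFun_injective <| by
    simp only [toMatrixFun_star, toMatrixFun_add, star_add]

instance : StarModule ℂ (CrossedProduct α) where
  star_smul r x := toMatrixFun_injective <| by
    simp only [toMatrixFun_star, toMatrixFun_smul, star_smul]

/-- The standard embedding `A ⋊ G ⊆ M_G(A)`, `a ⊗ g ↦ ∑ c, α_c(a) E_{c, c + g}`. -/
def toMatrix (α : Multiplicative G →* (A ≃⋆ₐ[ℂ] A)) :
    CrossedProduct α →⋆ₐ[ℂ] CStarMatrix G G A where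
  toFun := toMatrixFun
  map_one' := toMatrixFun_one
  map_mul' := toMatrixFun_mul
  map_zero' := toMatrixFun_zero
  map_add' := toMatrixFun_add
  commutes' r := by
    rw [Algebra.algebraMap_eq_smul_one, Algebra.algebraMap_eq_smul_one, toMatrixFun_smul,
      toMatrixFun_one]
  map_star' := toMatrixFun_star

/-- The `C*`-norm of the crossed product, induced by the standard embedding into the
`C*`-algebra `M_G(A)`. -/
instance : NormedRing (CrossedProduct α) :=
  letI := CStarAlgebra.spectralOrder A
  haveI := CStarAlgebra.spectralOrderedRing A
  NormedRing.induced (CrossedProduct α) (CStarMatrix G G A) (toMatrix α) toMatrixFun_injective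

theorem isometry_toMatrix :
    letI := CStarAlgebra.spectralOrder A
    haveI := CStarAlgebra.spectralOrderedRing A
    Isometry (toMatrix α) := by
  letI := CStarAlgebra.spectralOrder A
  haveI := CStarAlgebra.spectralOrderedRing A
  exact AddMonoidHomClass.isometry_of_norm (toMatrix α) fun _ => rfl

instance : NormedAlgebra ℂ (CrossedProduct α) where
  norm_smul_le r x := by
    letI := CStarAlgebra.spectralOrder A
    haveI := CStarAlgebra.spectralOrderedRing A
    change ‖toMatrix α (r • x)‖ ≤ ‖r‖ * ‖toMatrix α x‖
    rw [map_smul]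
    exact norm_smul_le r _

instance : CStarRing (CrossedProduct α) where
  norm_mul_self_le x := by
    letI := CStarAlgebra.spectralOrder A
    haveI := CStarAlgebra.spectralOrderedRing A
    change ‖toMatrix α x‖ * ‖toMatrix α x‖ ≤ ‖toMatrix α (star x * x)‖
    rw [map_mul, map_star]
    exact CStarRing.norm_mul_self_le _

instance : CompleteSpace (CrossedProduct α) := by
  letI := CStarAlgebra.spectralOrder A
  haveI := CStarAlgebra.spectralOrderedRing A
  have hr : Set.range (toMatrix α) =
      {M : CStarMatrix G G A | ∀ c d, M c d = act α c (M 0 (-c + d))} := by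
    ext M
    constructor
    · rintro ⟨x, rfl⟩ c d
      change act α c (x.coeff (-c + d)) = act α c (act α 0 (x.coeff (-0 + (-c + d))))
      simp [act_zero]
    · intro hM
      refine ⟨⟨fun g => M 0 g⟩, ?_⟩
      ext c d
      exact (hM c d).symm
  have hev : ∀ c d : G, Continuous fun M : CStarMatrix G G A => M c d := fun c d =>
    (continuous_apply d).comp (continuous_apply (A := fun _ : G => G → A) c)
  have hact : ∀ c : G, Continuous (act α c) := fun c =>
    (StarAlgEquiv.isometry (act α c)).continuous
  refine (completeSpace_iff_isComplete_range (isometry_toMatrix (α := α)).isUniformInducing).2 ?_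
  refine IsClosed.isComplete ?_
  rw [hr]
  simp only [Set.ofPred_forall]
  exact isClosed_iInter fun c => isClosed_iInter fun d =>
    isClosed_eq (hev c d) ((hact c).comp (hev 0 _))

instance : CStarAlgebra (CrossedProduct α) where

end Algebra

end CrossedProduct

/-! ## Powers of the complex sphere and the cyclic action -/

/-- The standard complex sphere `S^{N-1}_ℂ = {z ∈ ℂᴺ : ∑ |zᵢ|² = 1}`. -/
abbrev ComplexSphere (N : ℕ) : Type := Metric.sphere (0 : EuclideanSpace ℂ (Fin N)) 1

/-- The product `(S^{N-1}_ℂ)^K` of `K` copies of the complex sphere, the factors being indexed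
modulo `K`. -/
abbrev SpherePower (N K : ℕ) : Type := ZMod K → ComplexSphere N

/-- The coordinate functions `a_{i,c}(z₀, …, z_{K-1}) = (z_c)ᵢ`. -/
def coordFun {N K : ℕ} (i : Fin N) (c : ZMod K) : C(SpherePower N K, ℂ) where
  toFun x := (x c : EuclideanSpace ℂ (Fin N)) i
  continuous_toFun := by fun_prop

/-- The homeomorphism `τᵍ` of `(S^{N-1}_ℂ)^K`, where `τ` is the cyclic permutation
`τ(z₀, …, z_{K-1}) = (z_{K-1}, z₀, …, z_{K-2})`. -/
def cyclicShift (N K : ℕ) (g : ZMod K) : SpherePower N K ≃ₜ SpherePower N K where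
  toFun x c := x (c - g)
  invFun x c := x (c + g)
  left_inv x := by simp
  right_inv x := by simp
  continuous_toFun := by fun_prop
  continuous_invFun := by fun_prop

/-- The action of `ℤ_K` on `C((S^{N-1}_ℂ)^K)` induced by the cyclic permutation of the factors:
`g` acts by `f ↦ f ∘ τ⁻ᵍ`. -/
def cyclicAction (N K : ℕ) [NeZero K] :
    Multiplicative (ZMod K) →*
      (C(SpherePower N K, ℂ) ≃⋆ₐ[ℂ] C(SpherePower N K, ℂ)) where
  toFun g := (cyclicShift N K g.toAdd).symm.compStarAlgEquiv' ℂ ℂ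
  map_one' := by
    ext f x
    change f (fun c => x (c + 0)) = f x
    simp
  map_mul' g h := by
    ext f x
    change f (fun c => x (c + (g.toAdd + h.toAdd))) = f (fun c => x (c + h.toAdd + g.toAdd))
    congr 1
    funext c
    congr 1
    ring

end

/-!
Monomials of length `K` and their adjoints generate a commutative `*`-algebra, the block algebra.
Averaging over the gauge action `zᵢ ↦ ω zᵢ` of the `K`-th roots of unity is a faithful conditional
expectation onto its closure, and the model intertwines it with `a ⊗ g ↦ δ_{g,0} a`. Injectivity of
the model therefore reduces to injectivity on the block algebra, where it can be tested on
characters `χ`. The relations imply `zᵢ w zⱼ = zⱼ w zᵢ` for every monomial `w` of length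
`K - 1`, so the tensor `χ(z_{i₁} ⋯ z_{i_K})` satisfies the equations of a tensor of rank one. As it
has norm one, it is a tensor product of `K` points of the sphere, and `χ` is evaluation at a point
of the sphere power.
-/

/-! ## Half-liberated tuples -/

/-- The noncommutative monomial `z_{i₁} ⋯ z_{iₙ}` spelled by the list of indices `[i₁, …, iₙ]`. -/
def word {ι M : Type*} [Monoid M] (z : ι → M) (l : List ι) : M := (l.map z).prod

section Word

variable {ι M : Type*} [Monoid M] (z : ι → M)

@[simp] theorem word_nil : word z [] = 1 := rfl

@[simp] theorem word_cons (i : ι) (l : List ι) : word z (i :: l) = z i * word z l :=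
  List.prod_cons

@[simp] theorem word_append (l m : List ι) : word z (l ++ m) = word z l * word z m := by
  simp [word]

theorem word_concat (l : List ι) (i : ι) : word z (l ++ [i]) = word z l * z i := by simp

theorem word_ofFn {n : ℕ} (f : Fin n → ι) :
    word z (List.ofFn f) = (List.ofFn fun k => z (f k)).prod := by
  rw [word, List.map_ofFn, Function.comp_def]

theorem map_word {M' F : Type*} [Monoid M'] [FunLike F M M'] [MonoidHomClass F M M'] (φ : F)
    (l : List ι) : φ (word z l) = word (φ ∘ z) l := by
  rw [word, map_list_prod, List.map_map, word]

theorem word_smul {R A : Type*} [CommMonoid R] [Monoid A] [MulAction R A] [IsScalarTower R A A]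
    [SMulCommClass R A A] (c : R) (a : ι → A) (l : List ι) :
    word (c • a) l = c ^ l.length • word a l := by
  induction l with
  | nil => simp
  | cons i l ih =>
    rw [word_cons, word_cons, ih, Pi.smul_apply, smul_mul_smul_comm, List.length_cons, pow_succ']

theorem star_word [StarMul M] (l : List ι) : star (word z l) = word (star z) l.reverse := by
  induction l with
  | nil => simp
  | cons i l ih => simp [ih]

end Word

theorem exists_ofFn_eq {α : Type*} {n : ℕ} {l : List α} (hl : l.length = n) :
    ∃ f : Fin n → α, List.ofFn f = l := by
  subst hl
  exact ⟨l.get, List.ofFn_get l⟩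

theorem ofFn_update {α : Type*} {n : ℕ} (f : Fin n → α) (c : Fin n) (a : α) :
    List.ofFn (Function.update f c a) =
      (List.ofFn f).take c ++ a :: (List.ofFn f).drop (c + 1) := by
  have h : List.ofFn (Function.update f c a) = (List.ofFn f).set c a := by
    refine List.ext_getElem (by simp) fun k h₁ h₂ => ?_
    simp [List.getElem_set, Function.update_apply, Fin.ext_iff, eq_comm]
  rw [h, List.set_eq_take_append_cons_drop, if_pos (by simp)]

namespace IsHalfLiberated

variable {N K : ℕ} {B : Type*} [Ring B] [StarRing B] {z : Fin N → B}

theorem sum_word_mul_star (hz : IsHalfLiberated K z) (n : ℕ) :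
    ∑ f : Fin n → Fin N, word z (List.ofFn f) * star (word z (List.ofFn f)) = 1 := by
  induction n with
  | zero => simp
  | succ n ih =>
    calc
      _ = ∑ i, ∑ f : Fin n → Fin N,
            z i * (word z (List.ofFn f) * star (word z (List.ofFn f))) * star (z i) := by
          rw [← (Fin.consEquiv fun _ => Fin N).sum_comp, Fintype.sum_prod_type]
          simp [List.ofFn_succ, mul_assoc]
      _ = ∑ i, z i * star (z i) := by simp_rw [← Finset.sum_mul, ← Finset.mul_sum, ih, mul_one]
      _ = 1 := hz.sum_mul_star

theorem sum_star_mul_word (hz : IsHalfLiberated K z) (n : ℕ) :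
    ∑ f : Fin n → Fin N, star (word z (List.ofFn f)) * word z (List.ofFn f) = 1 := by
  induction n with
  | zero => simp
  | succ n ih =>
    calc
      _ = ∑ i, ∑ f : Fin n → Fin N,
            star (z i) * (star (word z (List.ofFn f)) * word z (List.ofFn f)) * z i := by
          rw [← (Fin.snocEquiv fun _ => Fin N).sum_comp, Fintype.sum_prod_type]
          simp [List.ofFn_succ', -List.ofFn_succ, List.concat_eq_append, Fin.snocEquiv, mul_assoc]
      _ = ∑ i, star (z i) * z i := by simp_rw [← Finset.sum_mul, ← Finset.mul_sum, ih, mul_one]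
      _ = 1 := hz.sum_star_mul

theorem commute_word (hz : IsHalfLiberated K z) {l m : List (Fin N)} (hl : l.length = K)
    (hm : m.length = K) : Commute (word z l) (word z m) := by
  obtain ⟨i, rfl⟩ := exists_ofFn_eq hl
  obtain ⟨j, rfl⟩ := exists_ofFn_eq hm
  simpa only [word_ofFn] using hz.commute i j

theorem commute_word_star (hz : IsHalfLiberated K z) {l m : List (Fin N)} (hl : l.length = K)
    (hm : m.length = K) : Commute (word z l) (star (word z m)) := by
  obtain ⟨i, rfl⟩ := exists_ofFn_eq hl
  obtain ⟨j, hj⟩ := exists_ofFn_eq (m.length_reverse.trans hm)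
  simpa only [star_word, ← hj, word_ofFn, Pi.star_apply] using hz.commute_star i j

theorem of_word (h₁ : ∑ i, z i * star (z i) = 1) (h₂ : ∑ i, star (z i) * z i = 1)
    (hc : ∀ l m : List (Fin N), l.length = K → m.length = K → Commute (word z l) (word z m))
    (hcs : ∀ l m : List (Fin N), l.length = K → m.length = K →
      Commute (word z l) (star (word z m))) : IsHalfLiberated K z where
  sum_mul_star := h₁
  sum_star_mul := h₂
  commute i j := by
    simpa only [word_ofFn] using hc (List.ofFn i) (List.ofFn j) (by simp) (by simp)
  commute_star i j := by
    have := hcs (List.ofFn i) (List.ofFn j).reverse (by simp) (by simp)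
    simpa only [star_word, List.reverse_reverse, word_ofFn, Pi.star_apply] using this

/-- The `*`-algebra generated by the monomials of length `K`. It is commutative by the relations,
and plays the role of the functions on the quotient of the half-liberated sphere by `ℤ_K`. -/
def blockAlgebra [Algebra ℂ B] [StarModule ℂ B] (K : ℕ) (z : Fin N → B) : StarSubalgebra ℂ B :=
  StarAlgebra.adjoin ℂ {x | ∃ l : List (Fin N), l.length = K ∧ word z l = x}

variable [Algebra ℂ B] [StarModule ℂ B]

theorem isMulCommutative_blockAlgebra (hz : IsHalfLiberated K z) :
    IsMulCommutative (blockAlgebra K z) := by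
  apply StarAlgebra.isMulCommutative_adjoin
  · rintro _ ⟨l, hl, rfl⟩ _ ⟨m, hm, rfl⟩
    exact hz.commute_word hl hm
  · rintro _ ⟨l, hl, rfl⟩ _ ⟨m, hm, rfl⟩
    exact hz.commute_word_star hl hm

theorem commute_of_mem_blockAlgebra (hz : IsHalfLiberated K z) {a b : B}
    (ha : a ∈ blockAlgebra K z) (hb : b ∈ blockAlgebra K z) : Commute a b := by
  have := hz.isMulCommutative_blockAlgebra
  exact congrArg Subtype.val (mul_comm' (⟨a, ha⟩ : blockAlgebra K z) ⟨b, hb⟩)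

theorem word_mem_blockAlgebra {l : List (Fin N)} (hl : K ∣ l.length) :
    word z l ∈ blockAlgebra K z := by
  obtain ⟨n, hn⟩ := hl
  induction n generalizing l with
  | zero => simp [List.length_eq_zero_iff.1 hn]
  | succ n ih =>
    rw [← l.take_append_drop K, word_append]
    refine mul_mem (StarAlgebra.subset_adjoin ℂ _ ⟨_, ?_, rfl⟩) (ih ?_)
    · simp [hn, mul_add]
    · simp [hn, mul_add]

theorem word_mul_star_word_mem (hz : IsHalfLiberated K z) [NeZero K] {l m : List (Fin N)}
    (h : l.length ≡ m.length [MOD K]) : word z l * star (word z m) ∈ blockAlgebra K z := by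
  obtain ⟨n, hn⟩ : ∃ n, K ∣ l.length + n := by
    obtain ⟨k, rfl⟩ := Nat.exists_eq_succ_of_ne_zero (NeZero.ne K)
    exact ⟨k * l.length, l.length, by rw [Nat.succ_eq_add_one]; ring⟩
  have hn' : K ∣ m.length + n := (Nat.ModEq.dvd_iff (h.add_right n) dvd_rfl).1 hn
  have hsum : word z l * star (word z m) = ∑ f : Fin n → Fin N,
      word z (l ++ List.ofFn f) * star (word z (m ++ List.ofFn f)) := by
    rw [← mul_one (word z l), ← hz.sum_word_mul_star n, Finset.mul_sum, Finset.sum_mul]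
    simp only [word_append, star_mul, mul_assoc]
  rw [hsum]
  refine sum_mem fun f _ => mul_mem (word_mem_blockAlgebra ?_) (star_mem (word_mem_blockAlgebra ?_))
  · simpa using hn
  · simpa using hn'

theorem mul_word_mul_comm (hz : IsHalfLiberated K z) [NeZero K] {l : List (Fin N)}
    (hl : l.length + 1 = K) (i j : Fin N) :
    z i * word z l * z j = z j * word z l * z i := by
  have hcomm (f : Fin l.length → Fin N) :
      z i * word z l * (z j * word z (List.ofFn f)) =
        z j * word z (List.ofFn f) * (z i * word z l) := by
    simpa using (hz.commute_word (l := i :: l) (m := j :: List.ofFn f) (by simpa) (by simpa)).eq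
  have hcomm' (f : Fin l.length → Fin N) :
      word z (List.ofFn f) * z i * (word z l * star (word z (List.ofFn f))) =
        word z l * star (word z (List.ofFn f)) * (word z (List.ofFn f) * z i) := by
    rw [← word_concat]
    exact hz.commute_of_mem_blockAlgebra (word_mem_blockAlgebra (by simp [hl]))
      (hz.word_mul_star_word_mem (by simp [Nat.ModEq]))
  -- Insert `1 = ∑ w w*` over the monomials `w` of length `K - 1` on the right, so that `zⱼ` becomes
  -- part of a monomial of length `K`.
  calc
    z i * word z l * z j
      = ∑ f : Fin l.length → Fin N,
          z i * word z l * (z j * word z (List.ofFn f)) * star (word z (List.ofFn f)) := by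
        rw [← mul_one (_ * z j), ← hz.sum_word_mul_star l.length, Finset.mul_sum]
        simp only [mul_assoc]
    _ = ∑ f : Fin l.length → Fin N,
          z j * (word z (List.ofFn f) * z i * (word z l * star (word z (List.ofFn f)))) := by
        simp only [hcomm, mul_assoc]
    _ = ∑ f : Fin l.length → Fin N,
          z j * word z l * (star (word z (List.ofFn f)) * word z (List.ofFn f)) * z i := by
        simp only [hcomm', mul_assoc]
    _ = z j * word z l * z i := by
        rw [← Finset.sum_mul, ← Finset.mul_sum, hz.sum_star_mul_word, mul_one]

theorem word_mul_word_swap (hz : IsHalfLiberated K z) [NeZero K] {u v u' v' : List (Fin N)}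
    {i j : Fin N} (hu : u.length = u'.length) (hl : (u ++ i :: v).length = K) :
    word z (u ++ i :: v) * word z (u' ++ j :: v') =
      word z (u ++ j :: v) * word z (u' ++ i :: v') := by
  have h := hz.mul_word_mul_comm (l := v ++ u') (by grind) i j
  calc
    _ = word z u * (z i * word z (v ++ u') * z j) * word z v' := by simp [mul_assoc]
    _ = word z u * (z j * word z (v ++ u') * z i) * word z v' := by rw [h]
    _ = _ := by simp [mul_assoc]

theorem word_mul_word_update (hz : IsHalfLiberated K z) [NeZero K] (I J : Fin K → Fin N)
    (c : Fin K) :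
    word z (List.ofFn I) * word z (List.ofFn J) =
      word z (List.ofFn (Function.update I c (J c))) *
        word z (List.ofFn (Function.update J c (I c))) := by
  have hI := ofFn_update I c (I c)
  have hJ := ofFn_update J c (J c)
  rw [Function.update_eq_self] at hI hJ
  rw [ofFn_update, ofFn_update, ← hz.word_mul_word_swap (by simp) (by grind), ← hI, ← hJ]

/-- The products `a z_{i₁} ⋯ z_{iₙ}` with `a` in the block algebra. -/
def blockMonomials (K : ℕ) (z : Fin N → B) : Set B :=
  {x | ∃ a ∈ blockAlgebra K z, ∃ l, a * word z l = x}

theorem mul_letter_mem_span {x : B}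
    (hx : x ∈ Submodule.span ℂ (blockMonomials K z)) (i : Fin N) :
    x * z i ∈ Submodule.span ℂ (blockMonomials K z) := by
  suffices h : Submodule.span ℂ (blockMonomials K z) ≤
      (Submodule.span ℂ (blockMonomials K z)).comap (LinearMap.mulRight ℂ (z i)) from h hx
  rw [Submodule.span_le]
  rintro _ ⟨a, ha, l, rfl⟩
  exact Submodule.subset_span ⟨a, ha, l ++ [i], by simp [mul_assoc]⟩

theorem mul_star_letter_mem_span (hz : IsHalfLiberated K z) [NeZero K] {x : B}
    (hx : x ∈ Submodule.span ℂ (blockMonomials K z)) (i : Fin N) :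
    x * star (z i) ∈ Submodule.span ℂ (blockMonomials K z) := by
  suffices h : Submodule.span ℂ (blockMonomials K z) ≤
      (Submodule.span ℂ (blockMonomials K z)).comap (LinearMap.mulRight ℂ (star (z i))) from h hx
  rw [Submodule.span_le]
  rintro _ ⟨a, ha, l, rfl⟩
  obtain ⟨n, hn⟩ : ∃ n, n + 1 = l.length + K :=
    ⟨l.length + (K - 1), by have := NeZero.one_le (n := K); omega⟩
  have hexpand : a * word z l * star (z i) = ∑ f : Fin n → Fin N,
      a * (word z l * star (word z (List.ofFn f ++ [i]))) * word z (List.ofFn f) := by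
    rw [← mul_one (_ * star (z i)), ← hz.sum_star_mul_word n, Finset.mul_sum]
    simp only [word_concat, star_mul, mul_assoc]
  rw [SetLike.mem_coe, Submodule.mem_comap, LinearMap.mulRight_apply, hexpand]
  refine sum_mem fun f _ => Submodule.subset_span ⟨_, mul_mem ha ?_, _, rfl⟩
  exact hz.word_mul_star_word_mem (by simp [hn, Nat.ModEq])

theorem mul_eval_mem_span (hz : IsHalfLiberated K z) [NeZero K] (p : FreeStarAlg N) {x : B}
    (hx : x ∈ Submodule.span ℂ (blockMonomials K z)) :
    x * FreeStarAlg.eval z p ∈ Submodule.span ℂ (blockMonomials K z) := by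
  induction p using FreeStarAlg.induction generalizing x with
  | hs c =>
    rw [AlgHomClass.commutes, ← Algebra.commutes, ← Algebra.smul_def]
    exact Submodule.smul_mem _ c hx
  | hl i =>
    rw [FreeStarAlg.eval_letter]
    cases i with
    | inl i => exact mul_letter_mem_span hx i
    | inr i => exact hz.mul_star_letter_mem_span hx i
  | hm p q hp hq =>
    rw [map_mul, ← mul_assoc]
    exact hq (hp hx)
  | ha p q hp hq =>
    rw [map_add, mul_add]
    exact add_mem (hp hx) (hq hx)

theorem eval_mem_span (hz : IsHalfLiberated K z) [NeZero K] (p : FreeStarAlg N) :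
    FreeStarAlg.eval z p ∈ Submodule.span ℂ (blockMonomials K z) := by
  simpa using hz.mul_eval_mem_span p (Submodule.subset_span ⟨1, one_mem _, [], mul_one 1⟩)

end IsHalfLiberated

/-! ## The universal property -/

namespace HLPoly

variable {N K : ℕ}

/-- The generator `zᵢ` of the algebra of `*`-polynomials. -/
noncomputable def gen (i : Fin N) : HLPoly N K := FreeStarAlg.letter (Sum.inl i)

theorem eval_gen {B : Type*} [Ring B] [StarRing B] [Algebra ℂ B] [StarModule ℂ B] (z : Fin N → B)
    (i : Fin N) : eval z (gen i : HLPoly N K) = z i :=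
  FreeStarAlg.eval_letter z (Sum.inl i)

theorem starAlgHom_ext {B : Type*} [Ring B] [StarRing B] [Algebra ℂ B]
    {φ ψ : HLPoly N K →⋆ₐ[ℂ] B} (h : ∀ i, φ (gen i) = ψ (gen i)) : φ = ψ := by
  ext p
  induction p using FreeStarAlg.induction with
  | hs c => exact (AlgHomClass.commutes φ c).trans (AlgHomClass.commutes ψ c).symm
  | hl x =>
    cases x with
    | inl i => exact h i
    | inr i =>
      have hstar : star (gen i : HLPoly N K) = FreeStarAlg.letter (Sum.inr i) :=
        FreeStarAlg.star_letter (Sum.inl i)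
      rw [← hstar]
      exact (map_star φ _).trans ((congrArg star (h i)).trans (map_star ψ _).symm)
  | hm p q hp hq => exact (map_mul φ p q).trans ((congrArg₂ _ hp hq).trans (map_mul ψ p q).symm)
  | ha p q hp hq => exact (map_add φ p q).trans ((congrArg₂ _ hp hq).trans (map_add ψ p q).symm)

end HLPoly

namespace HLSphere

open UniformSpace HLPoly
open scoped CStarAlgebra

variable {N K : ℕ}

/-- `HLSphere.ofPoly` as a `*`-homomorphism. -/
noncomputable def ofPolyHom (N K : ℕ) : HLPoly N K →⋆ₐ[ℂ] HLSphere N K where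
  toFun := ofPoly
  map_one' := rfl
  map_mul' := ofPoly_mul
  map_zero' := rfl
  map_add' := ofPoly_add
  commutes' _ := rfl
  map_star' p := (star_ofPoly p).symm

theorem ofPolyHom_eq_of_eval_eq {p q : HLPoly N K}
    (h : ∀ (B : Type) [CStarAlgebra B] (z : Fin N → B), IsHalfLiberated K z →
      HLPoly.eval z p = HLPoly.eval z q) : ofPolyHom N K p = ofPolyHom N K q := by
  have hnorm : ‖p - q‖ ≤ 0 :=
    norm_le_of le_rfl fun B _ z hz => by rw [map_sub, h B z hz, sub_self, norm_zero]
  rw [← sub_eq_zero, ← map_sub, ← norm_le_zero_iff]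
  exact (norm_ofPoly _).trans_le hnorm

theorem isHalfLiberated_z (N K : ℕ) : IsHalfLiberated K (z : Fin N → HLSphere N K) := by
  have hword (l : List (Fin N)) : ofPolyHom N K (word gen l) = word z l := map_word _ _ l
  have heval (B : Type) [CStarAlgebra B] (y : Fin N → B) (l : List (Fin N)) :
      HLPoly.eval y (word gen l : HLPoly N K) = word y l := by
    rw [map_word]
    exact congrArg (word · l) (funext (eval_gen y))
  refine .of_word ?_ ?_ (fun l m hl hm => ?_) fun l m hl hm => ?_
  · calc
      _ = ofPolyHom N K (∑ i, gen i * star (gen i)) := by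
        simp only [map_sum, map_mul, map_star]; rfl
      _ = ofPolyHom N K 1 := ofPolyHom_eq_of_eval_eq fun B _ y hy => by
        simp only [map_sum, map_mul, map_star, map_one, eval_gen, hy.sum_mul_star]
      _ = 1 := map_one _
  · calc
      _ = ofPolyHom N K (∑ i, star (gen i) * gen i) := by
        simp only [map_sum, map_mul, map_star]; rfl
      _ = ofPolyHom N K 1 := ofPolyHom_eq_of_eval_eq fun B _ y hy => by
        simp only [map_sum, map_mul, map_star, map_one, eval_gen, hy.sum_star_mul]
      _ = 1 := map_one _
  · rw [← hword, ← hword, Commute, SemiconjBy, ← map_mul, ← map_mul]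
    refine ofPolyHom_eq_of_eval_eq fun B _ y hy => ?_
    rw [map_mul, map_mul, heval, heval]
    exact hy.commute_word hl hm
  · rw [← hword, ← hword, ← map_star, Commute, SemiconjBy, ← map_mul, ← map_mul]
    refine ofPolyHom_eq_of_eval_eq fun B _ y hy => ?_
    rw [map_mul, map_mul, map_star, heval, heval]
    exact hy.commute_word_star hl hm

theorem eval_z (p : HLPoly N K) : HLPoly.eval z p = ofPoly p :=
  congrArg (· p) (starAlgHom_ext (φ := HLPoly.eval z) (ψ := ofPolyHom N K) fun i => eval_gen z i)

section Lift

variable {B : Type} [CStarAlgebra B] {y : Fin N → B}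

theorem continuous_eval (hy : IsHalfLiberated K y) :
    Continuous (HLPoly.eval y : HLPoly N K → B) :=
  AddMonoidHomClass.continuous_of_bound (HLPoly.eval y : HLPoly N K →⋆ₐ[ℂ] B) 1 fun p =>
    (norm_eval_le p hy).trans_eq (one_mul _).symm

/-- The extension by continuity of evaluation at a tuple satisfying the relations. -/
noncomputable def liftRingHom (hy : IsHalfLiberated K y) : HLSphere N K →+* B :=
  Completion.extensionHom (HLPoly.eval (K := K) y : HLPoly N K →+* B) (continuous_eval hy)

theorem liftRingHom_ofPoly (hy : IsHalfLiberated K y) (p : HLPoly N K) :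
    liftRingHom hy (ofPoly p) = HLPoly.eval y p :=
  Completion.extensionHom_coe _ (continuous_eval hy) p

/-- The universal property of the half-liberated sphere: `N` elements of a `C*`-algebra satisfying
its relations are the images of the generators under a `*`-homomorphism. -/
noncomputable def lift (hy : IsHalfLiberated K y) : HLSphere N K →⋆ₐ[ℂ] B where
  toRingHom := liftRingHom hy
  commutes' c := (liftRingHom_ofPoly hy (algebraMap ℂ (HLPoly N K) c)).trans
    (AlgHomClass.commutes (HLPoly.eval y) c)
  map_star' x := by
    refine denseRange_ofPoly.induction_on
      (p := fun x => liftRingHom hy (star x) = star (liftRingHom hy x)) x ?_ fun p => ?_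
    · exact isClosed_eq (Completion.continuous_extension.comp continuous_star)
        (continuous_star.comp Completion.continuous_extension)
    · simp only [star_ofPoly, liftRingHom_ofPoly, map_star]

theorem lift_z (hy : IsHalfLiberated K y) (i : Fin N) : lift hy (z i) = y i :=
  (liftRingHom_ofPoly hy _).trans (eval_gen y i)

theorem starAlgHom_ext {φ ψ : HLSphere N K →⋆ₐ[ℂ] B} (h : ∀ i, φ (z i) = ψ (z i)) : φ = ψ := by
  have hpoly : φ.comp (ofPolyHom N K) = ψ.comp (ofPolyHom N K) := HLPoly.starAlgHom_ext h
  exact DFunLike.coe_injective <| denseRange_ofPoly.equalizer (map_continuous φ)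
    (map_continuous ψ) (congrArg DFunLike.coe hpoly)

end Lift
end HLSphere

/-! ## The gauge action -/

section StarHomCLM

open scoped CStarAlgebra

variable {A B : Type*} [CStarAlgebra A] [CStarAlgebra B]

/-- A `*`-homomorphism between `C*`-algebras as a continuous linear map. -/
noncomputable def starHomCLM (φ : A →⋆ₐ[ℂ] B) : A →L[ℂ] B :=
  ⟨φ.toAlgHom.toLinearMap, map_continuous φ⟩

@[simp] theorem starHomCLM_apply (φ : A →⋆ₐ[ℂ] B) (a : A) : starHomCLM φ a = φ a := rfl

end StarHomCLM

theorem zmod_toCircle_pow_card {K : ℕ} [NeZero K] (c : ZMod K) : ZMod.toCircle c ^ K = 1 := by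
  rw [← AddChar.map_nsmul_eq_pow, nsmul_eq_mul, CharP.cast_eq_zero, zero_mul,
    AddChar.map_zero_eq_one]

theorem IsHalfLiberated.smul {N K : ℕ} {B : Type*} [Ring B] [StarRing B] [Algebra ℂ B]
    [StarModule ℂ B] {z : Fin N → B} (hz : IsHalfLiberated K z) {c : ℂ} (hc : ‖c‖ = 1) :
    IsHalfLiberated K (c • z) := by
  have hcc : c * conj c = 1 := by simp [Complex.mul_conj, Complex.normSq_eq_norm_sq, hc]
  refine .of_word ?_ ?_ (fun l m hl hm => ?_) fun l m hl hm => ?_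
  · simp [smul_smul, hcc, mul_comm (conj c), hz.sum_mul_star]
  · simp [smul_smul, hcc, hz.sum_star_mul]
  · rw [word_smul, word_smul]
    exact ((hz.commute_word hl hm).smul_left _).smul_right _
  · rw [word_smul, word_smul, star_smul]
    exact ((hz.commute_word_star hl hm).smul_left _).smul_right _

namespace HLSphere

open IsHalfLiberated
open scoped CStarAlgebra

variable {N K : ℕ}

/-- The gauge automorphism `zᵢ ↦ u zᵢ`. -/
noncomputable def gauge (u : Circle) : HLSphere N K →⋆ₐ[ℂ] HLSphere N K :=
  lift ((isHalfLiberated_z N K).smul u.norm_coe)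

theorem gauge_z (u : Circle) (i : Fin N) : gauge u (z i : HLSphere N K) = (u : ℂ) • z i :=
  lift_z _ i

theorem gauge_one : gauge 1 = StarAlgHom.id ℂ (HLSphere N K) :=
  starAlgHom_ext fun i => by simp [gauge_z]

theorem gauge_word (u : Circle) (l : List (Fin N)) :
    gauge u (word z l : HLSphere N K) = (u : ℂ) ^ l.length • word z l := by
  rw [map_word, show gauge u ∘ z = (u : ℂ) • (z : Fin N → HLSphere N K) from funext (gauge_z u),
    word_smul]

theorem gauge_of_mem_blockAlgebra {u : Circle} (hu : u ^ K = 1) {a : HLSphere N K}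
    (ha : a ∈ blockAlgebra K z) : gauge u a = a := by
  suffices h : blockAlgebra K z ≤
      StarAlgHom.equalizer (gauge u) (StarAlgHom.id ℂ (HLSphere N K)) from h ha
  refine StarAlgHom.adjoin_le_equalizer _ _ ?_
  rintro _ ⟨l, hl, rfl⟩
  rw [gauge_word, hl, ← Circle.coe_pow, hu, Circle.coe_one, one_smul]
  rfl

variable [NeZero K]

theorem dense_span_blockMonomials :
    Dense (Submodule.span ℂ (blockMonomials K (z : Fin N → HLSphere N K)) : Set (HLSphere N K)) :=
  denseRange_ofPoly.mono <| by
    rintro _ ⟨p, rfl⟩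
    rw [← eval_z]
    exact (isHalfLiberated_z N K).eval_mem_span p

variable (N K) in
/-- The conditional expectation onto the fixed points of the gauge action of the `K`-th roots of
unity. -/
noncomputable def expectation : HLSphere N K →L[ℂ] HLSphere N K :=
  (K : ℂ)⁻¹ • ∑ c : ZMod K, starHomCLM (gauge (ZMod.toCircle c))

theorem expectation_apply (x : HLSphere N K) :
    expectation N K x = (K : ℂ)⁻¹ • ∑ c : ZMod K, gauge (ZMod.toCircle c) x := by
  simp [expectation]

theorem expectation_mul_word {a : HLSphere N K} (ha : a ∈ blockAlgebra K z) (l : List (Fin N)) :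
    expectation N K (a * word z l) = if (l.length : ZMod K) = 0 then a * word z l else 0 := by
  have hgauge (c : ZMod K) : gauge (ZMod.toCircle c) (a * word z l) =
      ZMod.stdAddChar (c * (l.length : ZMod K)) • (a * word z l) := by
    rw [map_mul, gauge_of_mem_blockAlgebra (zmod_toCircle_pow_card c) ha, gauge_word, mul_smul_comm,
      mul_comm c, ← nsmul_eq_mul, AddChar.map_nsmul_eq_pow]
    rfl
  rw [expectation_apply, Finset.sum_congr rfl fun c _ => hgauge c, ← Finset.sum_smul,
    AddChar.sum_mulShift _ (ZMod.isPrimitive_stdAddChar K), smul_smul]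
  split_ifs <;> simp [ZMod.card, NeZero.ne K]

theorem expectation_mem_closure (x : HLSphere N K) :
    expectation N K x ∈ (blockAlgebra K (z : Fin N → HLSphere N K)).topologicalClosure := by
  suffices h : Submodule.span ℂ (blockMonomials K z) ≤
      (blockAlgebra K z).toSubalgebra.toSubmodule.comap (expectation N K).toLinearMap from
    map_mem_closure (expectation N K).continuous (dense_span_blockMonomials x) h
  rw [Submodule.span_le]
  rintro _ ⟨a, ha, l, rfl⟩
  change expectation N K _ ∈ blockAlgebra K z
  rw [expectation_mul_word ha]
  split_ifs with hl
  · exact mul_mem ha (word_mem_blockAlgebra ((ZMod.natCast_eq_zero_iff _ _).1 hl))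
  · exact zero_mem _

theorem eq_zero_of_expectation_star_mul_self_eq_zero {x : HLSphere N K}
    (hx : expectation N K (star x * x) = 0) : x = 0 := by
  let _ := CStarAlgebra.spectralOrder (HLSphere N K)
  have := CStarAlgebra.spectralOrderedRing (HLSphere N K)
  have hnonneg (c : ZMod K) : 0 ≤ gauge (ZMod.toCircle c) (star x * x) := by
    rw [map_mul, map_star]
    exact star_mul_self_nonneg _
  rw [expectation_apply, smul_eq_zero_iff_right (inv_ne_zero (Nat.cast_ne_zero.2 (NeZero.ne K))),
    Finset.sum_eq_zero_iff_of_nonneg fun c _ => hnonneg c] at hx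
  have h := hx 0 (Finset.mem_univ 0)
  rw [AddChar.map_zero_eq_one, gauge_one] at h
  exact (CStarRing.star_mul_self_eq_zero_iff x).1 h

end HLSphere

/-! ## The model in the crossed product -/

namespace CrossedProduct

open scoped CStarAlgebra

variable {G A : Type*} [AddGroup G] [DecidableEq G] [CStarAlgebra A]
  {α : Multiplicative G →* (A ≃⋆ₐ[ℂ] A)}

theorem coeff_tmul (a : A) (g : G) : (tmul a g : CrossedProduct α).coeff = Pi.single g a := rfl

theorem star_tmul (a : A) (g : G) :
    star (tmul a g : CrossedProduct α) = tmul (act α (-g) (star a)) (-g) := by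
  ext k
  change act α k (star ((Pi.single g a : G → A) (-k))) = _
  rw [coeff_tmul]
  obtain rfl | hk := eq_or_ne k (-g)
  · simp
  · simp [hk, neg_eq_iff_eq_neg]

variable [Fintype G]

theorem tmul_mul_tmul (a b : A) (g h : G) :
    (tmul a g * tmul b h : CrossedProduct α) = tmul (a * act α g b) (g + h) := by
  ext k
  change ∑ g', (Pi.single g a : G → A) g' * act α g' ((Pi.single h b : G → A) (-g' + k)) = _
  rw [Finset.sum_eq_single g (by simp +contextual) (by simp), coeff_tmul, Pi.single_eq_same]
  obtain rfl | hk := eq_or_ne k (g + h)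
  · simp
  · simp [hk, neg_add_eq_iff_eq_add]

variable (α) in
/-- The embedding `a ↦ a ⊗ 0` of the coefficient algebra. -/
def incl : A →⋆ₐ[ℂ] CrossedProduct α where
  toFun a := tmul a 0
  map_one' := rfl
  map_mul' a b := by rw [tmul_mul_tmul, act_zero, add_zero]
  map_zero' := CrossedProduct.ext (Pi.single_zero (M := fun _ : G => A) 0)
  map_add' a b := CrossedProduct.ext (Pi.single_add (f := fun _ : G => A) 0 a b)
  commutes' r := by
    rw [Algebra.algebraMap_eq_smul_one, Algebra.algebraMap_eq_smul_one]
    exact CrossedProduct.ext (Pi.single_smul (f := fun _ : G => A) 0 r 1)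
  map_star' a := by rw [star_tmul, neg_zero, act_zero]

theorem incl_apply (a : A) : incl α a = tmul a 0 := rfl

theorem coeff_incl_zero (a : A) : (incl α a).coeff 0 = a :=
  Pi.single_eq_same (M := fun _ : G => A) 0 a

theorem incl_injective : Function.Injective (incl α) :=
  Function.LeftInverse.injective (g := (coeff · 0)) (coeff_incl_zero (α := α))

theorem isometry_incl : Isometry (incl α) :=
  NonUnitalStarAlgHom.isometry (incl α) incl_injective

theorem tmul_mul_star_tmul (a b : A) (g : G) :
    tmul a g * star (tmul b g) = incl α (a * star b) := by
  rw [star_tmul, tmul_mul_tmul, act_act, add_neg_cancel, act_zero, incl_apply]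

theorem star_tmul_mul_tmul (a b : A) (g : G) :
    star (tmul a g) * tmul b g = incl α (act α (-g) (star a * b)) := by
  rw [star_tmul, tmul_mul_tmul, neg_add_cancel, ← map_mul, incl_apply]

theorem norm_coeff_le (x : CrossedProduct α) (g : G) : ‖x.coeff g‖ ≤ ‖x‖ := by
  let _ := CStarAlgebra.spectralOrder A
  have := CStarAlgebra.spectralOrderedRing A
  calc ‖x.coeff g‖ = ‖toMatrix α x 0 g‖ := by
        change _ = ‖act α 0 (x.coeff (-0 + g))‖
        rw [act_zero, neg_zero, zero_add]
    _ ≤ ‖x‖ := CStarMatrix.norm_entry_le_norm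

/-- The coefficient at a group element as a continuous linear map. -/
noncomputable def coeffCLM (g : G) : CrossedProduct α →L[ℂ] A :=
  LinearMap.mkContinuous ⟨⟨fun x => x.coeff g, fun _ _ => rfl⟩, fun _ _ => rfl⟩ 1 fun x =>
    (norm_coeff_le x g).trans_eq (one_mul _).symm

theorem coeffCLM_apply (g : G) (x : CrossedProduct α) : coeffCLM g x = x.coeff g := rfl

end CrossedProduct

section Model

open CrossedProduct

variable {N K : ℕ}

/-- The monomial `a_{l₁,s} a_{l₂,s+1} a_{l₃,s+2} ⋯` in the coordinate functions. -/
noncomputable def cyclicMonomial : ZMod K → List (Fin N) → C(SpherePower N K, ℂ)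
  | _, [] => 1
  | s, i :: l => coordFun i s * cyclicMonomial (s + 1) l

theorem cyclicMonomial_ofFn_apply (x : SpherePower N K) {n : ℕ} (f : Fin n → Fin N) (s : ZMod K) :
    cyclicMonomial s (List.ofFn f) x = ∏ k : Fin n, (x (s + (k : ℕ))).1 (f k) := by
  induction n generalizing s with
  | zero => simp [cyclicMonomial]
  | succ n ih =>
    rw [List.ofFn_succ, Fin.prod_univ_succ, cyclicMonomial, ContinuousMap.mul_apply, ih]
    simp [coordFun, add_comm, add_left_comm]

theorem sum_coordFun_mul_star (c : ZMod K) :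
    ∑ i : Fin N, coordFun i c * star (coordFun i c) = (1 : C(SpherePower N K, ℂ)) := by
  ext x
  have hx : (∑ i, ‖(x c).1 i‖ ^ 2 : ℝ) = 1 := by
    rw [← EuclideanSpace.norm_sq_eq, norm_eq_of_mem_sphere, one_pow]
  simp only [ContinuousMap.sum_apply, ContinuousMap.mul_apply, ContinuousMap.star_apply,
    ContinuousMap.one_apply, coordFun, ContinuousMap.coe_mk, RCLike.star_def, Complex.mul_conj']
  exact_mod_cast hx

variable [NeZero K]

theorem act_cyclicMonomial (g s : ZMod K) (l : List (Fin N)) :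
    act (cyclicAction N K) g (cyclicMonomial s l) = cyclicMonomial (s + g) l := by
  induction l generalizing s with
  | nil => exact map_one _
  | cons i l ih =>
    rw [cyclicMonomial, map_mul, ih, cyclicMonomial, add_right_comm]
    rfl

/-- The images `aᵢ₀ ⊗ τ` of the generators under the model. -/
noncomputable def modelGen (N K : ℕ) [NeZero K] (i : Fin N) : CrossedProduct (cyclicAction N K) :=
  tmul (coordFun i 0) 1

theorem word_modelGen (l : List (Fin N)) :
    word (modelGen N K) l = tmul (cyclicMonomial 0 l) (l.length : ZMod K) := by
  induction l with
  | nil => rw [List.length_nil, Nat.cast_zero]; rfl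
  | cons i l ih =>
    rw [word_cons, ih, modelGen, tmul_mul_tmul, act_cyclicMonomial, cyclicMonomial,
      List.length_cons, Nat.cast_succ, add_comm 1]

theorem word_modelGen_of_dvd {l : List (Fin N)} (hl : K ∣ l.length) :
    word (modelGen N K) l = incl _ (cyclicMonomial 0 l) := by
  rw [word_modelGen, (ZMod.natCast_eq_zero_iff _ _).2 hl, incl_apply]

theorem isHalfLiberated_modelGen (N K : ℕ) [NeZero K] : IsHalfLiberated K (modelGen N K) := by
  refine .of_word ?_ ?_ (fun l m hl hm => ?_) fun l m hl hm => ?_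
  · simp only [modelGen, tmul_mul_star_tmul, ← map_sum, sum_coordFun_mul_star, map_one]
  · simp only [modelGen, star_tmul_mul_tmul, mul_comm (star _), ← map_sum, sum_coordFun_mul_star,
      map_one]
  · rw [word_modelGen_of_dvd hl.symm.dvd, word_modelGen_of_dvd hm.symm.dvd]
    exact (Commute.all _ _).map _
  · rw [word_modelGen_of_dvd hl.symm.dvd, word_modelGen_of_dvd hm.symm.dvd, ← map_star]
    exact (Commute.all _ _).map _

namespace HLSphere

open IsHalfLiberated
open scoped CStarAlgebra

variable (N K) in
/-- The representation of the half-liberated sphere in the crossed product. -/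
noncomputable def model : HLSphere N K →⋆ₐ[ℂ] CrossedProduct (cyclicAction N K) :=
  lift (isHalfLiberated_modelGen N K)

theorem model_z (i : Fin N) : model N K (z i) = tmul (coordFun i 0) 1 := lift_z _ i

theorem model_word (l : List (Fin N)) :
    model N K (word z l) = tmul (cyclicMonomial 0 l) (l.length : ZMod K) := by
  rw [map_word, ← word_modelGen]
  exact congrArg (word · l) (funext model_z)

theorem model_word_of_dvd {l : List (Fin N)} (hl : K ∣ l.length) :
    model N K (word z l) = incl _ (cyclicMonomial 0 l) := by
  rw [model_word, (ZMod.natCast_eq_zero_iff _ _).2 hl, incl_apply]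

variable (N K) in
/-- The closed `*`-algebra generated by the monomials of length `K`. -/
noncomputable abbrev blockCStar : StarSubalgebra ℂ (HLSphere N K) :=
  (blockAlgebra K z).topologicalClosure

theorem model_mem_range_incl {a : HLSphere N K} (ha : a ∈ blockCStar N K) :
    model N K a ∈ (incl (cyclicAction N K)).range := by
  suffices h : blockCStar N K ≤ (incl (cyclicAction N K)).range.comap (model N K) from h ha
  refine StarSubalgebra.topologicalClosure_minimal ?_
    (isometry_incl.isClosedEmbedding.isClosed_range.preimage (map_continuous (model N K)))
  refine StarAlgebra.adjoin_le ?_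
  rintro _ ⟨l, hl, rfl⟩
  exact ⟨cyclicMonomial 0 l, (model_word_of_dvd hl.symm.dvd).symm⟩

theorem model_expectation (x : HLSphere N K) :
    model N K (expectation N K x) = incl _ ((model N K x).coeff 0) := by
  suffices h : (starHomCLM (model N K)).comp (expectation N K) =
      (starHomCLM (incl _)).comp ((coeffCLM 0).comp (starHomCLM (model N K))) from
    DFunLike.congr_fun h x
  refine ContinuousLinearMap.ext_on dense_span_blockMonomials ?_
  rintro _ ⟨a, ha, l, rfl⟩
  simp only [ContinuousLinearMap.comp_apply, starHomCLM_apply, coeffCLM_apply]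
  obtain ⟨b, hb : incl (cyclicAction N K) b = model N K a⟩ :=
    model_mem_range_incl (StarSubalgebra.le_topologicalClosure _ ha)
  rw [expectation_mul_word ha, apply_ite (model N K), map_zero, map_mul, ← hb, model_word,
    incl_apply b, tmul_mul_tmul, act_zero, zero_add, coeff_tmul, Pi.single_apply]
  split_ifs with hl h0 h0
  · rw [hl, incl_apply]
  · exact absurd hl.symm h0
  · exact absurd h0.symm hl
  · exact (map_zero _).symm

variable (N K) in
/-- The block algebra as an algebra of functions on the power of the sphere. -/
noncomputable def blockRep : blockCStar N K →⋆ₐ[ℂ] C(SpherePower N K, ℂ) :=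
  ((StarAlgEquiv.ofInjective (incl (cyclicAction N K)) incl_injective).symm : _ →⋆ₐ[ℂ] _).comp <|
    ((model N K).comp (blockCStar N K).subtype).codRestrict (incl (cyclicAction N K)).range
      fun a => model_mem_range_incl a.2

theorem incl_blockRep (a : blockCStar N K) :
    incl (cyclicAction N K) (blockRep N K a) = model N K a :=
  congrArg Subtype.val (StarAlgEquiv.apply_symm_apply
    (StarAlgEquiv.ofInjective (incl (cyclicAction N K)) incl_injective)
    ⟨model N K a, model_mem_range_incl a.2⟩)

end HLSphere
end Model

/-! ## Characters of the block algebra -/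

section RankOne

variable {ι α : Type*} [DecidableEq ι]

theorem mul_pow_card_eq_prod_update {R : Type*} [CommRing R] {T : (ι → α) → R}
    (hT : ∀ I J c, T I * T J = T (Function.update I c (J c)) * T (Function.update J c (I c)))
    (I J : ι → α) (s : Finset ι) :
    T (s.piecewise I J) * T J ^ s.card = T J * ∏ c ∈ s, T (Function.update J c (I c)) := by
  induction s using Finset.induction_on with
  | empty => simp
  | insert c s hc ih =>
    have h := hT ((insert c s).piecewise I J) J c
    rw [Finset.piecewise_insert, Function.update_self, Function.update_idem,
      ← Finset.piecewise_eq_of_notMem s I J hc, Function.update_eq_self] at h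
    rw [Finset.piecewise_insert, Finset.card_insert_of_notMem hc, Finset.prod_insert hc, pow_succ',
      ← mul_assoc, h]
    linear_combination T (Function.update J c (I c)) * ih

theorem exists_eq_prod_of_mul_eq_mul_update {k : Type*} [Field k] [Fintype ι] [Nonempty ι]
    {T : (ι → α) → k}
    (hT : ∀ I J c, T I * T J = T (Function.update I c (J c)) * T (Function.update J c (I c))) :
    ∃ y : ι → α → k, ∀ I, T I = ∏ c, y c (I c) := by
  by_cases h0 : ∀ J, T J = 0
  · exact ⟨0, fun I => by simp [h0]⟩
  obtain ⟨J, hJ⟩ := not_forall.1 h0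
  obtain ⟨c₀⟩ := ‹Nonempty ι›
  refine ⟨fun c i => (if c = c₀ then T J else 1) * (T (Function.update J c i) / T J), fun I => ?_⟩
  have h := mul_pow_card_eq_prod_update hT I J Finset.univ
  rw [Finset.piecewise_univ] at h
  rw [Finset.prod_mul_distrib, Finset.prod_div_distrib, Finset.prod_ite_eq' _ c₀,
    Finset.prod_const, if_pos (Finset.mem_univ _), ← mul_div_assoc, ← h,
    mul_div_cancel_right₀ _ (pow_ne_zero _ hJ)]

theorem prod_norm_toLp_sq [Fintype ι] [Fintype α] (y : ι → α → ℂ) :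
    ∏ c, ‖WithLp.toLp 2 (y c)‖ ^ 2 = ∑ I : ι → α, ‖∏ c, y c (I c)‖ ^ 2 := by
  simp only [EuclideanSpace.norm_sq_eq, Fintype.prod_sum, norm_prod, Finset.prod_pow]

theorem exists_sphere_prod_eq [Fintype ι] [Nonempty ι] {N : ℕ} {T : (ι → Fin N) → ℂ}
    (hT : ∀ I J c, T I * T J = T (Function.update I c (J c)) * T (Function.update J c (I c)))
    (h1 : ∑ I, ‖T I‖ ^ 2 = 1) :
    ∃ x : ι → ComplexSphere N, ∀ I, T I = ∏ c, (x c).1 (I c) := by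
  obtain ⟨y, hy⟩ := exists_eq_prod_of_mul_eq_mul_update hT
  simp only [hy, ← prod_norm_toLp_sq, Finset.prod_pow] at h1
  have hprod : ∏ c, ‖WithLp.toLp 2 (y c)‖ = 1 :=
    (pow_eq_one_iff_of_nonneg (Finset.prod_nonneg fun c _ => norm_nonneg _) two_ne_zero).1 h1
  have hne (c : ι) : ‖WithLp.toLp 2 (y c)‖ ≠ 0 := fun h =>
    zero_ne_one ((Finset.prod_eq_zero (Finset.mem_univ c) h).symm.trans hprod)
  refine ⟨fun c => ⟨(‖WithLp.toLp 2 (y c)‖ : ℂ)⁻¹ • WithLp.toLp 2 (y c), ?_⟩, fun I => ?_⟩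
  · simp [norm_smul, hne c]
  · have hprod' : ∏ c, (‖WithLp.toLp 2 (y c)‖ : ℂ) = 1 := by exact_mod_cast hprod
    simp [hy, Finset.prod_mul_distrib, hprod']

end RankOne

section Characters

open scoped CStarAlgebra

theorem eq_zero_of_forall_continuous_character_eq_zero {B : Type*} [CStarAlgebra B]
    {S : StarSubalgebra ℂ B} (hS : IsClosed (S : Set B)) (hcomm : ∀ a b : S, a * b = b * a) {a : S}
    (ha : ∀ χ : S →⋆ₐ[ℂ] ℂ, Continuous χ → χ a = 0) : a = 0 := by
  let _ : CommCStarAlgebra S :=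
    { (StarSubalgebra.cstarAlgebra S (h_closed := hS) : CStarAlgebra S) with mul_comm := hcomm }
  refine (gelfandTransform_isometry S).injective ?_
  rw [map_zero]
  ext χ
  exact ha (χ : S →⋆ₐ[ℂ] ℂ) (map_continuous χ)

end Characters

namespace HLSphere

open IsHalfLiberated CrossedProduct
open scoped CStarAlgebra

variable {N K : ℕ}

theorem blockCStar_mul_comm (a b : blockCStar N K) : a * b = b * a := by
  have := (isHalfLiberated_z N K).isMulCommutative_blockAlgebra
  let _ := StarSubalgebra.commRingTopologicalClosure
    (blockAlgebra K (z : Fin N → HLSphere N K)) mul_comm'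
  exact mul_comm a b

variable (K) in
/-- The monomial `z_{I 0} ⋯ z_{I (K - 1)}` as an element of the block algebra. -/
noncomputable def blockWord (I : Fin K → Fin N) : blockCStar N K :=
  ⟨word z (List.ofFn I),
    StarSubalgebra.le_topologicalClosure _ (word_mem_blockAlgebra (by simp))⟩

theorem sum_blockWord_mul_star :
    ∑ I, blockWord K I * star (blockWord K I) = (1 : blockCStar N K) := by
  refine Subtype.ext ?_
  rw [AddSubmonoidClass.coe_finsetSum]
  exact (isHalfLiberated_z N K).sum_word_mul_star K

theorem blockCStar_starAlgHom_ext {B : Type*} [TopologicalSpace B] [T2Space B] [Semiring B]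
    [StarRing B] [Algebra ℂ B] {φ ψ : blockCStar N K →⋆ₐ[ℂ] B}
    (hφ : Continuous φ) (hψ : Continuous ψ)
    (h : ∀ I, φ (blockWord K I) = ψ (blockWord K I)) : φ = ψ := by
  refine StarAlgHom.ext_topologicalClosure hφ hψ (StarAlgHom.ext_adjoin ?_)
  rintro ⟨_, _⟩ ⟨l, hl, rfl⟩
  obtain ⟨I, rfl⟩ := exists_ofFn_eq hl
  exact h I

variable [NeZero K]

theorem blockWord_mul_blockWord (I J : Fin K → Fin N) (c : Fin K) :
    blockWord K I * blockWord K J =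
      blockWord K (Function.update I c (J c)) * blockWord K (Function.update J c (I c)) :=
  Subtype.ext ((isHalfLiberated_z N K).word_mul_word_update I J c)

theorem blockRep_blockWord (I : Fin K → Fin N) :
    blockRep N K (blockWord K I) = cyclicMonomial 0 (List.ofFn I) :=
  incl_injective <| (incl_blockRep _).trans (model_word_of_dvd (by simp))

theorem exists_point_of_character (χ : blockCStar N K →⋆ₐ[ℂ] ℂ) :
    ∃ x : SpherePower N K, ∀ I, χ (blockWord K I) = blockRep N K (blockWord K I) x := by
  have hsum : ∑ I, ‖χ (blockWord K I)‖ ^ 2 = 1 := by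
    have h := congrArg χ (sum_blockWord_mul_star (N := N) (K := K))
    simp only [map_sum, map_mul, map_star, map_one, RCLike.star_def, Complex.mul_conj'] at h
    exact_mod_cast h
  obtain ⟨x, hx⟩ := exists_sphere_prod_eq (T := fun I => χ (blockWord K I))
    (fun I J c => by rw [← map_mul, blockWord_mul_blockWord I J c, map_mul]) hsum
  refine ⟨fun c => x ⟨c.val, ZMod.val_lt c⟩, fun I => ?_⟩
  rw [blockRep_blockWord, cyclicMonomial_ofFn_apply, hx]
  simp only [zero_add, ZMod.val_natCast_of_lt (Fin.isLt _)]

theorem continuous_blockRep : Continuous (blockRep N K) :=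
  isometry_incl.isUniformInducing.isInducing.continuous_iff.2 <|
    ((map_continuous (model N K)).comp continuous_subtype_val).congr fun a =>
      (incl_blockRep a).symm

theorem exists_character_eq_eval {χ : blockCStar N K →⋆ₐ[ℂ] ℂ} (hχ : Continuous χ) :
    ∃ x : SpherePower N K, ∀ a, χ a = blockRep N K a x := by
  obtain ⟨x, hx⟩ := exists_point_of_character χ
  refine ⟨x, DFunLike.congr_fun (g := (ContinuousMap.evalStarAlgHom ℂ ℂ x).comp (blockRep N K)) ?_⟩
  refine blockCStar_starAlgHom_ext hχ ?_ hx
  exact (continuous_eval_const (F := C(SpherePower N K, ℂ)) x).comp continuous_blockRep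

theorem blockRep_injective : Function.Injective (blockRep N K) := by
  refine (injective_iff_map_eq_zero _).2 fun a ha => ?_
  refine eq_zero_of_forall_continuous_character_eq_zero
    (StarSubalgebra.isClosed_topologicalClosure _) blockCStar_mul_comm fun χ hχ => ?_
  obtain ⟨x, hx⟩ := exists_character_eq_eval hχ
  rw [hx, ha, ContinuousMap.zero_apply]

theorem injective_model : Function.Injective (model N K) := by
  refine (injective_iff_map_eq_zero _).2 fun x hx => eq_zero_of_expectation_star_mul_self_eq_zero ?_
  have hzero : model N K (expectation N K (star x * x)) = 0 := by
    rw [model_expectation, map_mul, hx, mul_zero]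
    exact map_zero _
  let e : blockCStar N K := ⟨_, expectation_mem_closure (star x * x)⟩
  have he : blockRep N K e = 0 := incl_injective <| by rw [incl_blockRep, map_zero]; exact hzero
  exact congrArg Subtype.val (blockRep_injective (he.trans (map_zero _).symm))

end HLSphere

theorem theorem5p4 (N K : ℕ) [NeZero K] :
    ∃ π : HLSphere N K →⋆ₐ[ℂ] CrossedProduct (cyclicAction N K),
      (∀ i : Fin N, π (HLSphere.z i) = CrossedProduct.tmul (coordFun i 0) 1) ∧
      Function.Injective π ∧
      Function.Injective ((CrossedProduct.toMatrix (cyclicAction N K)).comp π) :=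
  ⟨HLSphere.model N K, HLSphere.model_z, HLSphere.injective_model,
    CrossedProduct.toMatrixFun_injective.comp HLSphere.injective_model⟩
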